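/- For an ordinal $\alpha$, $\mathsf{PEA}_\alpha$ is the class of polyadic equality algebras of dimension $\alpha$: Boolean algebras $A$ with operators $\mathsf c_{(\Gamma)}$ ($\Gamma\subseteq\alpha$), $\mathsf s_\tau$ ($\tau\in{}^{\alpha}\alpha$) and constants $\mathsf d_{ij}$ ($i,j<\alpha$) such that, for all $\Gamma,\Delta\subseteq\alpha$, $\sigma,\tau\in{}^\alpha\alpha$, $i,j<\alpha$ and $x,y\in A$: $\mathsf c_{(\Gamma)}0=0$; $x\le \mathsf c_{(\Gamma)}x$; $\mathsf c_{(\Gamma)}(x\cdot \mathsf c_{(\Gamma)}y)=\mathsf c_{(\Gamma)}x\cdot \mathsf c_{(\Gamma)}y$; $\mathsf c_{(\emptyset)}x=x$; $\mathsf c_{(\Gamma)}\mathsf c_{(\Delta)}x=\mathsf c_{(\Gamma\cup\Delta)}x$; $\mathsf s_\tau$ is a Boolean endomorphism; $\mathsf s_{\mathrm{Id}}x=x$; $\mathsf s_{\sigma\circ\tau}x=\mathsf s_\sigma \mathsf s_\tau x$; $\mathsf s_\sigma \mathsf c_{(\Gamma)}x=\mathsf s_\tau \mathsf c_{(\Gamma)}x$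 if $\sigma$ and $\tau$ agree off $\Gamma$; $\mathsf c_{(\Gamma)}\mathsf s_\tau x=\mathsf s_\tau \mathsf c_{(\tau^{-1}\Gamma)}x$ if $\tau$ is one-to-one on $\tau^{-1}\Gamma$; $\mathsf d_{ii}=1$; $x\cdot \mathsf d_{ij}\le \mathsf s_{[i/j]}x$, where $[i/j]$ sends $i$ to $j$ and fixes all other indices; $\mathsf s_\tau \mathsf d_{ij}=\mathsf d_{\tau(i)\tau(j)}$. For $\alpha\le\beta$ and $\mathfrak B\in\mathsf{PEA}_\beta$, the neat $\alpha$-reduct $\mathfrak{Nr}_\alpha\mathfrak B\in\mathsf{PEA}_\alpha$ has universe $\{b\in B:\mathsf c_{(\beta\setminus\alpha)}b=b\}$, with the Boolean operations, $\mathsf c_{(\Gamma)}$ for $\Gamma\subseteq\alpha$ and $\mathsf d_{ij}$ for $i,j<\alpha$ inherited from $\mathfrak B$, and with $\mathsf s_\tau$ for $\tau\in{}^\alpha\alpha$ computed as $\mathsf s^{\mathfrak B}_{\bar\tau}$, where $\bar\tau\in{}^\beta\beta$ extends $\tau$ by the identity on $\beta\setminus\alpha$. An ideal is a Boolean ideal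 closed under all $\mathsf c_{(\Gamma)}$ and $\mathsf s_\tau$. An algebra is simple if it has more than one element and its only ideals are $\{0\}$ and the whole algebra. **Lemma.** Let $\alpha$ be an infinite ordinal, $\beta>\alpha$ an ordinal, and $\mathfrak A\in\mathsf{PEA}_\alpha$. (1) There exist $\mathfrak B\in\mathsf{PEA}_\beta$ and an embedding of $\mathfrak A$ into $\mathfrak{Nr}_\alpha\mathfrak B$ such that, identifying $\mathfrak A$ with its image, every element of $\mathfrak B$ has the form $\mathsf s^{\mathfrak B}_\sigma a$ with $a\in A$ and $\sigma\in{}^\beta\beta$ such that $\sigma\upharpoonright\alpha$ is one-to-one. (2) Let $\mathfrak B\in\mathsf{PEA}_\beta$ be any algebra such that $\mathfrak A$ embeds as a subalgebra in $\mathfrak{Nr}_\alpha\mathfrak B$ and $A$ generates $\mathfrak B$ (no proper subalgebra of $\mathfrak B$ contains $A$). If $\mathfrak A$ is simple, then $\mathfrak B$ is simple. Moreover (whether or not $\mathfrak A$ is simple), every ideal $I$ of $\mathfrak B$ is the ideal of $\mathfrak B$ generated by $I\cap A$. -/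

import Mathlib

open Set Function
open scoped Ordinal

universe u v w

section PolyadicDefinitions

/-- The replacement `[i/j]`: it sends `i` to `j` and fixes every other index. -/
noncomputable def replacement {ι : Type u} (i j : ι) : ι → ι :=
  open Classical in fun k => if k = i then j else k

/-- Polyadic algebras with index set (dimension) `ι`: a Boolean algebra `A` with cylindrifications
`c_(Γ)` for all `Γ ⊆ ι` and substitutions `s_τ` for all `τ : ι → ι`, subject to the polyadic
axioms. -/
class PolyadicAlgebra (ι : Type u) (A : Type v) [BooleanAlgebra A] where
  /-- the cylindrification `c_(Γ)` -/
  cyl : Set ι → A → A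
  /-- the substitution `s_τ` -/
  subst : (ι → ι) → A → A
  cyl_bot : ∀ Γ, cyl Γ ⊥ = ⊥
  le_cyl : ∀ Γ x, x ≤ cyl Γ x
  cyl_inf_cyl : ∀ Γ x y, cyl Γ (x ⊓ cyl Γ y) = cyl Γ x ⊓ cyl Γ y
  cyl_empty : ∀ x, cyl ∅ x = x
  cyl_cyl : ∀ Γ Δ x, cyl Γ (cyl Δ x) = cyl (Γ ∪ Δ) x
  subst_sup : ∀ τ x y, subst τ (x ⊔ y) = subst τ x ⊔ subst τ y
  subst_compl : ∀ τ x, subst τ xᶜ = (subst τ x)ᶜ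
  subst_id : ∀ x, subst id x = x
  subst_comp : ∀ σ τ x, subst (σ ∘ τ) x = subst σ (subst τ x)
  subst_cyl_congr : ∀ Γ σ τ x, (∀ i, i ∉ Γ → σ i = τ i) →
    subst σ (cyl Γ x) = subst τ (cyl Γ x)
  cyl_subst : ∀ Γ τ x, InjOn τ (τ ⁻¹' Γ) → cyl Γ (subst τ x) = subst τ (cyl (τ ⁻¹' Γ) x)

/-- Polyadic equality algebras: polyadic algebras with diagonal elements `d_ij`. -/
class PolyadicEqualityAlgebra (ι : Type u) (A : Type v) [BooleanAlgebra A] extends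
    PolyadicAlgebra ι A where
  /-- the diagonal element `d_ij` -/
  diag : ι → ι → A
  diag_self : ∀ i, diag i i = ⊤
  inf_diag_le : ∀ i j x, x ⊓ diag i j ≤ subst (replacement i j) x
  subst_diag : ∀ τ i j, subst τ (diag i j) = diag (τ i) (τ j)

open PolyadicAlgebra PolyadicEqualityAlgebra

/-- Homomorphisms of polyadic equality algebras. -/
structure PolyadicEqualityHom (ι : Type u) (A : Type v) (B : Type w)
    [BooleanAlgebra A] [BooleanAlgebra B]
    [PolyadicEqualityAlgebra ι A] [PolyadicEqualityAlgebra ι B] extends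
    BoundedLatticeHom A B where
  map_cyl : ∀ (Γ : Set ι) (x : A), toFun (cyl Γ x) = cyl Γ (toFun x)
  map_subst : ∀ (τ : ι → ι) (x : A), toFun (subst τ x) = subst τ (toFun x)
  map_diag : ∀ i j : ι, toFun (diag i j) = diag i j

instance (ι : Type u) (A : Type v) (B : Type w)
    [BooleanAlgebra A] [BooleanAlgebra B]
    [PolyadicEqualityAlgebra ι A] [PolyadicEqualityAlgebra ι B] :
    CoeFun (PolyadicEqualityHom ι A B) (fun _ => A → B) where
  coe f := f.toFun

/-- Subalgebras: Boolean subalgebras closed under all cylindrifications and substitutions and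
containing all diagonal elements. -/
structure IsPolyadicEqualitySubalgebra (ι : Type u) {B : Type v} [BooleanAlgebra B]
    [PolyadicEqualityAlgebra ι B] (S : BooleanSubalgebra B) : Prop where
  cyl_mem : ∀ (Γ : Set ι) (x : B), x ∈ S → cyl Γ x ∈ S
  subst_mem : ∀ (τ : ι → ι) (x : B), x ∈ S → subst τ x ∈ S
  diag_mem : ∀ i j : ι, (diag i j : B) ∈ S

/-- `X` generates `B`: the only subalgebra of `B` containing `X` is `B` itself. -/
def PolyadicGenerates (ι : Type u) {B : Type v} [BooleanAlgebra B]
    [PolyadicEqualityAlgebra ι B] (X : Set B) : Prop :=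
  ∀ S : BooleanSubalgebra B, IsPolyadicEqualitySubalgebra ι S → X ⊆ S → ∀ b : B, b ∈ S

/-- Ideals of a polyadic (equality) algebra: Boolean ideals closed under all cylindrifications and
substitutions. -/
structure IsPolyadicIdeal (ι : Type u) {B : Type v} [BooleanAlgebra B] [PolyadicAlgebra ι B]
    (I : Order.Ideal B) : Prop where
  cyl_mem : ∀ (Γ : Set ι) (x : B), x ∈ I → cyl Γ x ∈ I
  subst_mem : ∀ (τ : ι → ι) (x : B), x ∈ I → subst τ x ∈ I

/-- The ideal generated by a set `X`: the intersection of all ideals that contain `X`. -/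
noncomputable def polyadicIdealGenerated (ι : Type u) {B : Type v} [BooleanAlgebra B]
    [PolyadicAlgebra ι B] (X : Set B) : Order.Ideal B :=
  sInf {I : Order.Ideal B | IsPolyadicIdeal ι I ∧ X ⊆ (I : Set B)}

/-- Simple algebras: those with more than one element in which `{0}` and the whole algebra are
the only ideals. -/
def IsPolyadicSimple (ι : Type u) (B : Type v) [BooleanAlgebra B] [PolyadicAlgebra ι B] : Prop :=
  Nontrivial B ∧ ∀ I : Order.Ideal B, IsPolyadicIdeal ι I → I = ⊥ ∨ I = ⊤

/-! ### Compressions and neat reducts -/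

/-- For `e : ι ↪ κ`, the extension of `τ : ι → ι` to `κ`: it acts as `τ` on the copy of `ι` in `κ`
and as the identity off it. -/
noncomputable def extendMap {ι : Type u} {κ : Type w} (e : ι ↪ κ) (τ : ι → ι) : κ → κ :=
  Function.extend e (e ∘ τ) id

section
variable {ι : Type u} {κ : Type w} (e : ι ↪ κ)

theorem extendMap_apply (τ : ι → ι) (i : ι) : extendMap e τ (e i) = e (τ i) :=
  e.injective.extend_apply _ _ i

theorem extendMap_of_notMem (τ : ι → ι) {k : κ} (hk : k ∉ range e) : extendMap e τ k = k :=
  Function.extend_apply' _ _ k (fun ⟨a, ha⟩ => hk ⟨a, ha⟩)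

theorem extendMap_mem_range_iff (τ : ι → ι) (k : κ) :
    extendMap e τ k ∈ range e ↔ k ∈ range e := by
  by_cases hk : k ∈ range e
  · obtain ⟨i, rfl⟩ := hk
    simp [extendMap_apply]
  · rw [extendMap_of_notMem e τ hk]

theorem extendMap_preimage_compl (τ : ι → ι) :
    extendMap e τ ⁻¹' (range e)ᶜ = (range e)ᶜ := by
  ext k
  simpa using (extendMap_mem_range_iff e τ k).not

theorem extendMap_id : extendMap e id = id := by
  ext k
  by_cases hk : k ∈ range e
  · obtain ⟨i, rfl⟩ := hk
    simp [extendMap_apply]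
  · simp [extendMap_of_notMem e id hk]

theorem extendMap_comp (σ τ : ι → ι) : extendMap e (σ ∘ τ) = extendMap e σ ∘ extendMap e τ := by
  ext k
  by_cases hk : k ∈ range e
  · obtain ⟨i, rfl⟩ := hk
    simp [extendMap_apply]
  · simp [extendMap_of_notMem e _ hk]

theorem extendMap_preimage_image (τ : ι → ι) (Γ : Set ι) :
    extendMap e τ ⁻¹' (e '' Γ) = e '' (τ ⁻¹' Γ) := by
  ext k
  by_cases hk : k ∈ range e
  · obtain ⟨i, rfl⟩ := hk
    simp [extendMap_apply]
  · have h1 : k ∉ e '' Γ := fun h => hk (image_subset_range _ _ h)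
    have h2 : k ∉ e '' (τ ⁻¹' Γ) := fun h => hk (image_subset_range _ _ h)
    simp only [mem_preimage, extendMap_of_notMem e τ hk, h1, h2]

theorem extendMap_replacement (i j : ι) :
    extendMap e (replacement i j) = replacement (e i) (e j) := by
  ext k
  by_cases hk : k ∈ range e
  · obtain ⟨l, rfl⟩ := hk
    rw [extendMap_apply]
    by_cases h : l = i <;> simp [replacement, h]
  · have h : k ≠ e i := fun h => hk ⟨i, h.symm⟩
    rw [extendMap_of_notMem e _ hk]
    simp [replacement, h]

end

section
variable {κ : Type w} {B : Type v} [BooleanAlgebra B] [PolyadicAlgebra κ B]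

theorem polyadic_cyl_inf_of_fixed {Γ : Set κ} {x y : B} (hx : cyl Γ x = x) (hy : cyl Γ y = y) :
    cyl Γ (x ⊓ y) = x ⊓ y := by
  conv_lhs => rw [← hy]
  rw [cyl_inf_cyl, hx, hy]

theorem polyadic_cyl_compl_of_fixed {Γ : Set κ} {x : B} (hx : cyl Γ x = x) :
    cyl Γ xᶜ = xᶜ := by
  refine le_antisymm ?_ (le_cyl _ _)
  rw [le_compl_iff_disjoint_right, disjoint_iff]
  conv_lhs => rw [← hx]
  rw [← cyl_inf_cyl, hx, compl_inf_eq_bot, cyl_bot]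

theorem polyadic_cyl_sup_of_fixed {Γ : Set κ} {x y : B} (hx : cyl Γ x = x) (hy : cyl Γ y = y) :
    cyl Γ (x ⊔ y) = x ⊔ y := by
  have := polyadic_cyl_compl_of_fixed (polyadic_cyl_inf_of_fixed
    (polyadic_cyl_compl_of_fixed hx) (polyadic_cyl_compl_of_fixed hy))
  simpa using this

end

theorem polyadic_cyl_diag {κ : Type w} {B : Type v} [BooleanAlgebra B]
    [PolyadicEqualityAlgebra κ B] {Γ : Set κ} {i j : κ} (hi : i ∉ Γ) (hj : j ∉ Γ) :
    cyl Γ (diag i j : B) = diag i j := by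
  classical
  let τ : κ → κ := fun k => if k ∈ Γ then i else k
  have hτ : τ ⁻¹' Γ = ∅ := by
    ext k
    by_cases hk : k ∈ Γ <;> simp [τ, hk, hi]
  have h : subst τ (diag i j : B) = diag i j := by
    rw [subst_diag]
    simp [τ, hj]
  conv_lhs => rw [← h]
  rw [cyl_subst _ _ _ (by simp [hτ]), hτ, cyl_empty, h]

section
variable {ι : Type u} {κ : Type w} (e : ι ↪ κ) (B : Type v) [BooleanAlgebra B]

/-- The carrier `{b ∈ B : c_(κ ∼ J) b = b}` of the `J`-compression of `B`, where `J ⊆ κ` is the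
copy of `ι` under `e`. -/
def neatReduct [PolyadicAlgebra κ B] : BooleanSubalgebra B where
  carrier := {b | cyl (range e)ᶜ b = b}
  supClosed' := fun _ ha _ hb => polyadic_cyl_sup_of_fixed ha hb
  infClosed' := fun _ ha _ hb => polyadic_cyl_inf_of_fixed ha hb
  compl_mem' := fun ha => polyadic_cyl_compl_of_fixed ha
  bot_mem' := cyl_bot _

variable {B} in
theorem mem_neatReduct [PolyadicAlgebra κ B] {b : B} :
    b ∈ neatReduct e B ↔ cyl (range e)ᶜ b = b := Iff.rfl

/-- The polyadic operations of the compression: `c_(Γ)` is computed in `B`, and the substitution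
of `τ` is `s_τ̄` of `B`, where `τ̄` extends `τ` by the identity. -/
noncomputable instance neatReduct.instPolyadicAlgebra [PolyadicAlgebra κ B] :
    PolyadicAlgebra ι (neatReduct e B) where
  cyl Γ x := ⟨cyl (e '' Γ) (x : B), by
    rw [mem_neatReduct, cyl_cyl, union_comm, ← cyl_cyl, (mem_neatReduct e).1 x.2]⟩
  subst τ x := ⟨subst (extendMap e τ) (x : B), by
    have hinj : InjOn (extendMap e τ) (extendMap e τ ⁻¹' (range e)ᶜ) := by
      rw [extendMap_preimage_compl]
      intro k hk l hl h
      rwa [extendMap_of_notMem e τ hk, extendMap_of_notMem e τ hl] at h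
    rw [mem_neatReduct, cyl_subst _ _ _ hinj, extendMap_preimage_compl,
      (mem_neatReduct e).1 x.2]⟩
  cyl_bot Γ := Subtype.ext (cyl_bot _)
  le_cyl Γ x := le_cyl (e '' Γ) (x : B)
  cyl_inf_cyl Γ x y := Subtype.ext (cyl_inf_cyl _ _ _)
  cyl_empty x := Subtype.ext (by simp [cyl_empty])
  cyl_cyl Γ Δ x := Subtype.ext (by simp [cyl_cyl, image_union])
  subst_sup τ x y := Subtype.ext (subst_sup _ _ _)
  subst_compl τ x := Subtype.ext (subst_compl _ _)
  subst_id x := Subtype.ext (by simp [extendMap_id, subst_id])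
  subst_comp σ τ x := Subtype.ext (by simp [extendMap_comp, subst_comp])
  subst_cyl_congr Γ σ τ x h := Subtype.ext (by
    refine subst_cyl_congr (A := B) (e '' Γ) _ _ (x : B) fun k hk => ?_
    by_cases hk' : k ∈ range e
    · obtain ⟨i, rfl⟩ := hk'
      rw [extendMap_apply, extendMap_apply, h i fun hi => hk (mem_image_of_mem _ hi)]
    · rw [extendMap_of_notMem e σ hk', extendMap_of_notMem e τ hk'])
  cyl_subst Γ τ x h := Subtype.ext (by
    have hinj : InjOn (extendMap e τ) (extendMap e τ ⁻¹' (e '' Γ)) := by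
      rw [extendMap_preimage_image]
      rintro _ ⟨i, hi, rfl⟩ _ ⟨j, hj, rfl⟩ hij
      rw [extendMap_apply, extendMap_apply] at hij
      rw [h hi hj (e.injective hij)]
    simp [cyl_subst _ _ _ hinj, extendMap_preimage_image])

/-- The compression of a polyadic equality algebra has the diagonal elements of `B` with indices
in `J`. -/
noncomputable instance neatReduct.instPolyadicEqualityAlgebra [PolyadicEqualityAlgebra κ B] :
    PolyadicEqualityAlgebra ι (neatReduct e B) where
  diag i j := ⟨diag (e i) (e j), polyadic_cyl_diag (by simp) (by simp)⟩
  diag_self i := Subtype.ext (diag_self _)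
  inf_diag_le i j x := by
    have h := inf_diag_le (e i) (e j) (x : B)
    rw [← extendMap_replacement] at h
    exact h
  subst_diag τ i j := Subtype.ext (by
    change subst (extendMap e τ) (diag (e i) (e j) : B) = diag (e (τ i)) (e (τ j))
    rw [subst_diag, extendMap_apply, extendMap_apply])

end

/-! ### Ordinal dimensions -/

/-- `PEA_α` for an ordinal `α`, the index set being the set of ordinals less than `α`. -/
abbrev PEA (α : Ordinal.{u}) (A : Type v) [BooleanAlgebra A] :=
  PolyadicEqualityAlgebra (Iio α) A

/-- The inclusion `α ⊆ β` for ordinals `α ≤ β`. -/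
def ordinalInclusion {α β : Ordinal.{u}} (h : α ≤ β) : Iio α ↪ Iio β :=
  embeddingOfSubset (Iio α) (Iio β) (Iio_subset_Iio h)

/-- The neat `α`-reduct of an algebra of dimension `β ≥ α`. -/
abbrev Nr {α β : Ordinal.{u}} (h : α ≤ β) (B : Type v) [BooleanAlgebra B] [PEA β B] :
    BooleanSubalgebra B :=
  neatReduct (ordinalInclusion h) B

end PolyadicDefinitions

/-! Write `ι` for the smaller index set, `κ` for the larger and `e` for the inclusion. Since `ι` is
infinite, any two maps `ι → κ` factor through one embedding `ρ : ι ↪ κ` (`exists_embedding_factor`).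
Hence finitely many formal elements s_σ a can be moved into a single copy of `A` along `ρ`, where
the axioms are those of `A`.

For existence, s_σ a is realised as the function θ ↦ s_{θ∘σ} a on maps `κ → ι`. Boolean operations
are pointwise and substitutions are precomposition. Cylindrifications are computed in a copy along
an embedding, and `dilationElement_cyl_congr` shows that the copy does not matter.

For the second part, the elements s_ρ a of `B` already form a subalgebra, so they exhaust `B` once
`A` generates. If θ is a left inverse of `ρ`, then s_{e∘θ} brings s_ρ a back to `a`. An ideal
therefore contains s_ρ a exactly when it contains `a`, and is determined by its trace on `A`. -/

open PolyadicAlgebra PolyadicEqualityAlgebra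

/-! ### Boolean consequences of the substitution axioms. -/

section Substitution
variable {ι : Type u} {A : Type v} [BooleanAlgebra A] [PolyadicAlgebra ι A]

theorem polyadic_subst_inf (τ : ι → ι) (x y : A) :
    subst τ (x ⊓ y) = subst τ x ⊓ subst τ y := by
  rw [← compl_inj_iff, ← subst_compl, compl_inf, subst_sup, subst_compl, subst_compl, compl_inf]

theorem polyadic_subst_bot (τ : ι → ι) : subst τ (⊥ : A) = ⊥ := by
  have h := polyadic_subst_inf τ (⊥ : A) ⊥ᶜ
  rwa [subst_compl, inf_compl_self, inf_compl_self] at h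

theorem polyadic_subst_top (τ : ι → ι) : subst τ (⊤ : A) = ⊤ := by
  rw [← compl_bot, subst_compl, polyadic_subst_bot, compl_bot]

theorem polyadic_subst_mono (τ : ι → ι) {x y : A} (h : x ≤ y) : subst τ x ≤ subst τ y := by
  rw [← sup_eq_right] at h ⊢
  rw [← subst_sup, h]

end Substitution

/-! ### Factoring maps through a common embedding. -/

section Embeddings
variable {ι : Type u} {κ : Type w}

/-- Two families indexed by an infinite type factor through a common embedding into any type that
contains a copy of the index type. -/
theorem exists_embedding_factor [Infinite ι] (e : ι ↪ κ) (σ τ : ι → κ) :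
    ∃ (ρ : ι ↪ κ) (σ' τ' : ι → ι), σ = ρ ∘ σ' ∧ τ = ρ ∘ τ' := by
  -- The summand `e` makes the range at least as large as `ι`; infinity of `ι` bounds it above. A
  -- bijection of `ι` with this range is the required `ρ`.
  let g : (ι ⊕ ι) ⊕ ι → κ := Sum.elim (Sum.elim σ τ) e
  have hle : Cardinal.lift.{u} (Cardinal.mk (range g)) ≤ Cardinal.lift.{w} (Cardinal.mk ι) := by
    refine Cardinal.mk_range_le_lift.trans ?_
    rw [Cardinal.lift_le, Cardinal.mk_sum, Cardinal.mk_sum]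
    simp [Cardinal.add_eq_self (Cardinal.aleph0_le_mk ι)]
  have hge : Cardinal.lift.{w} (Cardinal.mk ι) ≤ Cardinal.lift.{u} (Cardinal.mk (range g)) :=
    Cardinal.lift_mk_le'.2 ⟨⟨fun i => ⟨g (Sum.inr i), mem_range_self _⟩,
      fun i j h => e.injective (congrArg Subtype.val h)⟩⟩
  obtain ⟨ψ⟩ := Cardinal.lift_mk_eq'.1 (le_antisymm hge hle)
  have hψ : ∀ s, (ψ (ψ.symm ⟨g s, mem_range_self s⟩) : κ) = g s := fun s => by simp
  refine ⟨ψ.toEmbedding.trans (Embedding.subtype _),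
    fun i => ψ.symm ⟨g (Sum.inl (Sum.inl i)), mem_range_self _⟩,
    fun i => ψ.symm ⟨g (Sum.inl (Sum.inr i)), mem_range_self _⟩, ?_, ?_⟩
  · exact funext fun i => (hψ (Sum.inl (Sum.inl i))).symm
  · exact funext fun i => (hψ (Sum.inl (Sum.inr i))).symm

theorem exists_embedding_factor_pair [Infinite ι] (e : ι ↪ κ) (σ : ι → κ) (p q : κ) :
    ∃ (ρ : ι ↪ κ) (σ' : ι → ι) (k l : ι), σ = ρ ∘ σ' ∧ ρ k = p ∧ ρ l = q := by
  classical
  obtain ⟨i, j, hij⟩ := exists_pair_ne ι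
  -- The second family serves only to put `p` and `q` into the range of `ρ`.
  obtain ⟨ρ, σ', τ', hσ, hτ⟩ := exists_embedding_factor e σ (fun k => if k = i then p else q)
  refine ⟨ρ, σ', τ' i, τ' j, hσ, ?_, ?_⟩
  · simpa using (congrFun hτ i).symm
  · simpa [hij.symm] using (congrFun hτ j).symm

theorem Function.Embedding.exists_leftInverse_comp [Nonempty ι] (ρ : ι ↪ κ) :
    ∃ θ : κ → ι, θ ∘ ρ = id :=
  ⟨invFun ρ, invFun_comp ρ.injective⟩

end Embeddings

/-! ### The dilation and its Boolean structure. -/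

section Dilation
variable {ι : Type u} {κ : Type w} {A : Type v} [BooleanAlgebra A]

/-- The element `s_σ a` of the dilation, for `σ : ι → κ`, recorded by its images under all
substitutions `κ → ι`. -/
def dilationElement [PolyadicAlgebra ι A] (σ : ι → κ) (a : A) : (κ → ι) → A :=
  fun θ => subst (θ ∘ σ) a

section
variable [PolyadicAlgebra ι A]

theorem dilationElement_comp (σ : ι → κ) (τ : ι → ι) (a : A) :
    dilationElement (σ ∘ τ) a = dilationElement σ (subst τ a) :=
  funext fun θ => subst_comp (θ ∘ σ) τ a

theorem dilationElement_sup (σ : ι → κ) (a b : A) :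
    dilationElement σ (a ⊔ b) = dilationElement σ a ⊔ dilationElement σ b :=
  funext fun _ => subst_sup _ _ _

theorem dilationElement_inf (σ : ι → κ) (a b : A) :
    dilationElement σ (a ⊓ b) = dilationElement σ a ⊓ dilationElement σ b :=
  funext fun _ => polyadic_subst_inf _ _ _

theorem dilationElement_compl (σ : ι → κ) (a : A) :
    dilationElement σ aᶜ = (dilationElement σ a)ᶜ :=
  funext fun _ => subst_compl _ _

theorem dilationElement_bot (σ : ι → κ) : dilationElement σ (⊥ : A) = ⊥ :=
  funext fun _ => polyadic_subst_bot _

theorem dilationElement_top (σ : ι → κ) : dilationElement σ (⊤ : A) = ⊤ :=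
  funext fun _ => polyadic_subst_top _

theorem dilationElement_mono (σ : ι → κ) {a b : A} (h : a ≤ b) :
    dilationElement σ a ≤ dilationElement σ b :=
  fun _ => polyadic_subst_mono _ h

theorem dilationElement_injective [Nonempty ι] (ρ : ι ↪ κ) :
    Injective (dilationElement ρ : A → (κ → ι) → A) := by
  intro a b h
  obtain ⟨θ, hθ⟩ := ρ.exists_leftInverse_comp
  have h' := congrFun h θ
  simpa only [dilationElement, hθ, subst_id] using h'

/-- This makes cylindrification well defined. Both representations are carried to a common embedding
`π`, along which representatives are unique; the connecting maps are injective, so `cyl_subst`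
applies to them. -/
theorem dilationElement_cyl_congr [Infinite ι] (e : ι ↪ κ) {ρ ρ' : ι ↪ κ} {a b : A}
    (h : dilationElement ρ a = dilationElement ρ' b) (Γ : Set κ) :
    dilationElement ρ (cyl (ρ ⁻¹' Γ) a) = dilationElement ρ' (cyl (ρ' ⁻¹' Γ) b) := by
  obtain ⟨π, τ, τ', hτ, hτ'⟩ := exists_embedding_factor e ρ ρ'
  have key : ∀ (ρ : ι ↪ κ) (τ : ι → ι) (a : A), (ρ : ι → κ) = π ∘ τ →
      dilationElement ρ (cyl (ρ ⁻¹' Γ) a) = dilationElement π (cyl (π ⁻¹' Γ) (subst τ a)) := by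
    intro ρ τ a hτ
    have hinj : Injective τ := Injective.of_comp (hτ ▸ ρ.injective)
    rw [cyl_subst _ _ _ hinj.injOn, ← dilationElement_comp, ← hτ, ← preimage_comp, ← hτ]
  rw [hτ, hτ', dilationElement_comp, dilationElement_comp] at h
  rw [key ρ τ a hτ, key ρ' τ' b hτ', dilationElement_injective π h]

end

variable (A) in
/-- The dilation of an algebra of infinite dimension `ι` along an embedding of `ι` into `κ`. -/
def dilation [PolyadicAlgebra ι A] [Infinite ι] (e : ι ↪ κ) :
    BooleanSubalgebra ((κ → ι) → A) where
  carrier := {b | ∃ (σ : ι → κ) (a : A), b = dilationElement σ a}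
  supClosed' := by
    rintro _ ⟨σ, a, rfl⟩ _ ⟨τ, b, rfl⟩
    obtain ⟨ρ, σ', τ', rfl, rfl⟩ := exists_embedding_factor e σ τ
    exact ⟨ρ, subst σ' a ⊔ subst τ' b, by
      rw [dilationElement_sup, dilationElement_comp, dilationElement_comp]⟩
  infClosed' := by
    rintro _ ⟨σ, a, rfl⟩ _ ⟨τ, b, rfl⟩
    obtain ⟨ρ, σ', τ', rfl, rfl⟩ := exists_embedding_factor e σ τ
    exact ⟨ρ, subst σ' a ⊓ subst τ' b, by
      rw [dilationElement_inf, dilationElement_comp, dilationElement_comp]⟩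
  compl_mem' := by
    rintro _ ⟨σ, a, rfl⟩
    exact ⟨σ, aᶜ, (dilationElement_compl σ a).symm⟩
  bot_mem' := ⟨e, ⊥, (dilationElement_bot _).symm⟩

/-! ### The polyadic equality structure of the dilation and the embedding of `A`. -/

namespace dilation
variable [Infinite ι] (e : ι ↪ κ)

section
variable [PolyadicAlgebra ι A]

/-- `s_σ a` as an element of the dilation. -/
def mk (σ : ι → κ) (a : A) : dilation A e := ⟨dilationElement σ a, σ, a, rfl⟩

theorem mk_comp (σ : ι → κ) (τ : ι → ι) (a : A) : mk e (σ ∘ τ) a = mk e σ (subst τ a) :=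
  Subtype.ext (dilationElement_comp σ τ a)

theorem exists_mk_factor (x : dilation A e) (τ : ι → κ) :
    ∃ (ρ : ι ↪ κ) (a : A) (τ' : ι → ι), x = mk e ρ a ∧ τ = ρ ∘ τ' := by
  obtain ⟨_, σ, a, rfl⟩ := x
  obtain ⟨ρ, σ', τ', rfl, rfl⟩ := exists_embedding_factor e σ τ
  exact ⟨ρ, subst σ' a, τ', mk_comp e ρ σ' a, rfl⟩

theorem exists_mk (x : dilation A e) : ∃ (ρ : ι ↪ κ) (a : A), x = mk e ρ a := by
  obtain ⟨ρ, a, -, h, -⟩ := exists_mk_factor e x e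
  exact ⟨ρ, a, h⟩

theorem exists_mk₂ (x y : dilation A e) :
    ∃ (ρ : ι ↪ κ) (a b : A), x = mk e ρ a ∧ y = mk e ρ b := by
  obtain ⟨σ, b, rfl⟩ := exists_mk e y
  obtain ⟨ρ, a, σ', rfl, hσ⟩ := exists_mk_factor e x σ
  exact ⟨ρ, a, subst σ' b, rfl, by rw [hσ, mk_comp]⟩

/-- The cylindrifications of the dilation. -/
noncomputable def cylinder (Γ : Set κ) (x : dilation A e) : dilation A e :=
  mk e (exists_mk e x).choose
    (cyl ((exists_mk e x).choose ⁻¹' Γ) (exists_mk e x).choose_spec.choose)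

theorem cylinder_mk (Γ : Set κ) (ρ : ι ↪ κ) (a : A) :
    cylinder e Γ (mk e ρ a) = mk e ρ (cyl (ρ ⁻¹' Γ) a) :=
  Subtype.ext (dilationElement_cyl_congr e
    (congrArg Subtype.val (exists_mk e (mk e ρ a)).choose_spec.choose_spec).symm Γ)

/-- The substitutions of the dilation. -/
def substitution (τ : κ → κ) (x : dilation A e) : dilation A e :=
  ⟨fun θ => x.1 (θ ∘ τ), by
    obtain ⟨_, σ, a, rfl⟩ := x
    exact ⟨τ ∘ σ, a, rfl⟩⟩

theorem substitution_mk (τ : κ → κ) (σ : ι → κ) (a : A) :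
    substitution e τ (mk e σ a) = mk e (τ ∘ σ) a := rfl

theorem mk_inf (σ : ι → κ) (a b : A) : mk e σ (a ⊓ b) = mk e σ a ⊓ mk e σ b :=
  Subtype.ext (dilationElement_inf σ a b)

noncomputable instance instPolyadicAlgebra : PolyadicAlgebra κ (dilation A e) where
  cyl := cylinder e
  subst := substitution e
  cyl_bot Γ := by
    have h : (⊥ : dilation A e) = mk e e ⊥ := Subtype.ext (dilationElement_bot _).symm
    rw [h, cylinder_mk, cyl_bot]
  le_cyl Γ x := by
    obtain ⟨ρ, a, rfl⟩ := exists_mk e x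
    rw [cylinder_mk]
    exact dilationElement_mono ρ (le_cyl _ a)
  cyl_inf_cyl Γ x y := by
    obtain ⟨ρ, a, b, rfl, rfl⟩ := exists_mk₂ e x y
    rw [cylinder_mk, cylinder_mk, ← mk_inf, cylinder_mk, cyl_inf_cyl, mk_inf]
  cyl_empty x := by
    obtain ⟨ρ, a, rfl⟩ := exists_mk e x
    rw [cylinder_mk, preimage_empty, cyl_empty]
  cyl_cyl Γ Δ x := by
    obtain ⟨ρ, a, rfl⟩ := exists_mk e x
    rw [cylinder_mk, cylinder_mk, cylinder_mk, cyl_cyl, preimage_union]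
  subst_sup _ _ _ := rfl
  subst_compl _ _ := rfl
  subst_id _ := rfl
  subst_comp _ _ _ := rfl
  subst_cyl_congr Γ σ τ x h := by
    obtain ⟨ρ, a, rfl⟩ := exists_mk e x
    rw [cylinder_mk, substitution_mk, substitution_mk]
    -- As `π` is injective, agreement of `σ` and `τ` off `Γ` becomes agreement of `σ'` and `τ'` off
    -- `ρ ⁻¹' Γ`.
    obtain ⟨π, σ', τ', hσ, hτ⟩ := exists_embedding_factor e (σ ∘ ρ) (τ ∘ ρ)
    rw [hσ, hτ, mk_comp, mk_comp, subst_cyl_congr _ σ' τ' a fun i hi => π.injective ?_]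
    exact (congrFun hσ i).symm.trans ((h (ρ i) hi).trans (congrFun hτ i))
  cyl_subst Γ τ x h := by
    obtain ⟨ρ, a, rfl⟩ := exists_mk e x
    -- Only `τ ∘ ρ` needs factoring; the second family `e` is a dummy.
    obtain ⟨π, τ', -, hτ, -⟩ := exists_embedding_factor e (τ ∘ ρ) e
    have hpre : τ' ⁻¹' (π ⁻¹' Γ) = ρ ⁻¹' (τ ⁻¹' Γ) := by
      rw [← preimage_comp, ← hτ, preimage_comp]
    have hinj : InjOn τ' (τ' ⁻¹' (π ⁻¹' Γ)) := by
      rw [hpre]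
      intro i hi j hj hij
      refine ρ.injective (h hi hj ?_)
      exact (congrFun hτ i).trans ((congrArg π hij).trans (congrFun hτ j).symm)
    rw [cylinder_mk, substitution_mk, substitution_mk, hτ, mk_comp, mk_comp, cylinder_mk,
      cyl_subst _ _ _ hinj, hpre]

theorem cyl_mk (Γ : Set κ) (ρ : ι ↪ κ) (a : A) :
    cyl Γ (mk e ρ a) = mk e ρ (cyl (ρ ⁻¹' Γ) a) :=
  cylinder_mk e Γ ρ a

theorem subst_mk (τ : κ → κ) (σ : ι → κ) (a : A) :
    subst τ (mk e σ a) = mk e (τ ∘ σ) a := rfl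

end

variable [PolyadicEqualityAlgebra ι A]

/-- The diagonal elements of the dilation. -/
def diagonal (p q : κ) : dilation A e :=
  ⟨fun θ => diag (θ p) (θ q), by
    obtain ⟨ρ, -, k, l, -, rfl, rfl⟩ := exists_embedding_factor_pair e e p q
    exact ⟨ρ, diag k l, funext fun θ => (subst_diag (θ ∘ ρ) k l).symm⟩⟩

theorem diagonal_apply (σ : ι → κ) (k l : ι) :
    (diagonal e (σ k) (σ l) : dilation A e) = mk e σ (diag k l) :=
  Subtype.ext (funext fun θ => (subst_diag (θ ∘ σ) k l).symm)

noncomputable instance instPolyadicEqualityAlgebra :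
    PolyadicEqualityAlgebra κ (dilation A e) where
  diag := diagonal e
  diag_self p := Subtype.ext (funext fun θ => diag_self (θ p))
  inf_diag_le p q x := by
    obtain ⟨_, σ, a, rfl⟩ := x
    obtain ⟨ρ, σ', k, l, rfl, rfl, rfl⟩ := exists_embedding_factor_pair e σ p q
    change mk e (ρ ∘ σ') a ⊓ _ ≤ subst _ (mk e (ρ ∘ σ') a)
    have hr : replacement (ρ k) (ρ l) ∘ ρ = ρ ∘ replacement k l := by
      rw [← extendMap_replacement]
      exact funext fun i => extendMap_apply ρ _ i
    rw [mk_comp, diagonal_apply, subst_mk, hr, mk_comp, ← mk_inf]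
    exact dilationElement_mono ρ (inf_diag_le k l _)
  subst_diag _ _ _ := rfl

/-- The canonical map of an algebra into the compression of its dilation. -/
noncomputable def embed : PolyadicEqualityHom ι A (neatReduct e (dilation A e)) where
  toFun a := ⟨mk e e a, by
    rw [mem_neatReduct, cyl_mk, preimage_compl, preimage_range, compl_univ, cyl_empty]⟩
  map_sup' a b := Subtype.ext (Subtype.ext (dilationElement_sup _ a b))
  map_inf' a b := Subtype.ext (mk_inf e e a b)
  map_top' := Subtype.ext (Subtype.ext (dilationElement_top _))
  map_bot' := Subtype.ext (Subtype.ext (dilationElement_bot _))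
  map_cyl Γ a := by
    refine Subtype.ext ?_
    change mk e e (cyl Γ a) = cyl (e '' Γ) (mk e e a)
    rw [cyl_mk, preimage_image_eq _ e.injective]
  map_subst τ a := by
    refine Subtype.ext ?_
    change mk e e (subst τ a) = subst (extendMap e τ) (mk e e a)
    rw [subst_mk, ← mk_comp]
    congr 1
    exact funext fun i => (extendMap_apply e τ i).symm
  map_diag i j := Subtype.ext (diagonal_apply e e i j).symm

theorem embed_injective : Injective (embed (A := A) e) := fun _ _ h =>
  dilationElement_injective e (congrArg (fun x => x.1.1) h)

theorem exists_subst_embed (x : dilation A e) :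
    ∃ (a : A) (σ : κ → κ), InjOn σ (range e) ∧ x = subst σ (embed e a : dilation A e) := by
  obtain ⟨ρ, a, rfl⟩ := exists_mk e x
  have h : extend e ρ id ∘ e = ρ := extend_comp e.injective _ _
  refine ⟨a, extend e ρ id, ?_, ?_⟩
  · rintro _ ⟨i, rfl⟩ _ ⟨j, rfl⟩ hij
    rw [e.injective.extend_apply, e.injective.extend_apply] at hij
    rw [ρ.injective hij]
  · change _ = mk e (extend e ρ id ∘ e) a
    rw [h]

end dilation

end Dilation

/-! ### Algebras generated by a subalgebra of a neat reduct, and their ideals. -/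

namespace PolyadicEqualityHom
variable {ι : Type u} {κ : Type*} {A : Type v} {B : Type w} [BooleanAlgebra A] [BooleanAlgebra B]
  [PolyadicEqualityAlgebra ι A] [PolyadicEqualityAlgebra κ B] {e : ι ↪ κ}
  (f : PolyadicEqualityHom ι A (neatReduct e B))

theorem coe_sup (a b : A) : (f (a ⊔ b) : B) = (f a : B) ⊔ (f b : B) := congrArg Subtype.val (f.map_sup' a b)

theorem coe_inf (a b : A) : (f (a ⊓ b) : B) = (f a : B) ⊓ (f b : B) := congrArg Subtype.val (f.map_inf' a b)

theorem coe_bot : (f ⊥ : B) = ⊥ := congrArg Subtype.val f.map_bot'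

theorem coe_top : (f ⊤ : B) = ⊤ := congrArg Subtype.val f.map_top'

theorem coe_cyl (Γ : Set ι) (a : A) : (f (cyl Γ a) : B) = cyl (e '' Γ) (f a : B) :=
  congrArg Subtype.val (f.map_cyl Γ a)

theorem coe_subst (τ : ι → ι) (a : A) : (f (subst τ a) : B) = subst (extendMap e τ) (f a : B) :=
  congrArg Subtype.val (f.map_subst τ a)

theorem coe_diag (i j : ι) : (f (diag i j) : B) = diag (e i) (e j) :=
  congrArg Subtype.val (f.map_diag i j)

theorem coe_mono {a b : A} (h : a ≤ b) : (f a : B) ≤ f b := by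
  rw [← sup_eq_right] at h ⊢
  rw [← coe_sup, h]

theorem coe_compl (a : A) : (f aᶜ : B) = (f a : B)ᶜ := by
  refine (IsCompl.compl_eq ⟨?_, ?_⟩).symm
  · rw [disjoint_iff, ← coe_inf, inf_compl_self, coe_bot]
  · rw [codisjoint_iff, ← coe_sup, sup_compl_eq_top, coe_top]

/-- Elements of the neat reduct are fixed by cylindrification off `range e`, so the values of a
substitution there are irrelevant. -/
theorem subst_congr {σ τ : κ → κ} (h : σ ∘ e = τ ∘ e) (a : A) :
    subst σ (f a : B) = subst τ (f a : B) := by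
  rw [← (mem_neatReduct e).1 (f a).2]
  refine subst_cyl_congr _ _ _ _ fun k hk => ?_
  obtain ⟨i, rfl⟩ := not_notMem.1 hk
  exact congrFun h i

/-- `s_ρ a` in `B`, for `ρ : ι → κ`. -/
noncomputable def pull (ρ : ι → κ) (a : A) : B := subst (extend e ρ id) (f a : B)

theorem subst_eq_pull {σ : κ → κ} {ρ : ι → κ} (h : σ ∘ e = ρ) (a : A) :
    subst σ (f a : B) = f.pull ρ a :=
  f.subst_congr (h.trans (extend_comp e.injective _ _).symm) a

theorem pull_comp (ρ : ι → κ) (τ : ι → ι) (a : A) :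
    f.pull (ρ ∘ τ) a = f.pull ρ (subst τ a) := by
  unfold pull
  rw [coe_subst, ← subst_comp]
  refine f.subst_congr (funext fun i => ?_) a
  simp [extendMap_apply, e.injective.extend_apply]

theorem subst_pull (τ : κ → κ) (ρ : ι → κ) (a : A) :
    subst τ (f.pull ρ a) = f.pull (τ ∘ ρ) a := by
  unfold pull
  rw [← subst_comp]
  refine f.subst_congr (funext fun i => ?_) a
  simp [e.injective.extend_apply]

theorem pull_self (a : A) : f.pull e a = f a := by
  rw [← f.subst_eq_pull (id_comp _), subst_id]

/-- By `subst_congr`, `ρ` may be extended off `range e` by the constant `k` instead of the identity.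
No new index then lands in `Γ`, so the extension is injective on the preimage of `Γ`, as `cyl_subst`
demands. -/
theorem cyl_pull_of_notMem (ρ : ι ↪ κ) {Γ : Set κ} {k : κ} (hk : k ∉ Γ) (a : A) :
    cyl Γ (f.pull ρ a) = f.pull ρ (cyl (ρ ⁻¹' Γ) a) := by
  have hσ : extend e ρ (fun _ => k) ∘ e = ρ := extend_comp e.injective _ _
  have hmem : ∀ j, extend e ρ (fun _ => k) j ∈ Γ → j ∈ range e := by
    intro j hj
    by_contra h
    rw [extend_apply' _ _ _ h] at hj
    exact hk hj
  have hpre : extend e ρ (fun _ => k) ⁻¹' Γ = e '' (ρ ⁻¹' Γ) := by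
    refine Subset.antisymm (fun j hj => ?_) ?_
    · obtain ⟨i, rfl⟩ := hmem j hj
      rw [mem_preimage, e.injective.extend_apply] at hj
      exact ⟨i, hj, rfl⟩
    · rintro _ ⟨i, hi, rfl⟩
      rwa [mem_preimage, e.injective.extend_apply]
  have hinj : InjOn (extend e ρ fun _ => k) (extend e ρ (fun _ => k) ⁻¹' Γ) := by
    rw [hpre]
    rintro _ ⟨i, -, rfl⟩ _ ⟨j, -, rfl⟩ hij
    rw [e.injective.extend_apply, e.injective.extend_apply] at hij
    rw [ρ.injective hij]
  rw [← f.subst_eq_pull hσ, ← f.subst_eq_pull hσ, cyl_subst _ _ _ hinj, hpre, coe_cyl]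

/-- The trace of an ideal of `B` on `A`. -/
def idealComap (I : Order.Ideal B) :
    Order.Ideal A where
  carrier := {a | (f a : B) ∈ I}
  lower' _ _ h ha := I.lower (f.coe_mono h) ha
  nonempty' := ⟨⊥, by
    rw [mem_ofPred_eq, coe_bot]
    exact I.bot_mem⟩
  directed' a ha b hb := ⟨a ⊔ b, by
    rw [mem_ofPred_eq, coe_sup]
    exact I.sup_mem ha hb, le_sup_left, le_sup_right⟩

theorem isPolyadicIdeal_idealComap {I : Order.Ideal B} (hI : IsPolyadicIdeal κ I) :
    IsPolyadicIdeal ι (f.idealComap I) where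
  cyl_mem Γ a ha := by
    change (f _ : B) ∈ I
    rw [coe_cyl]
    exact hI.cyl_mem _ _ ha
  subst_mem τ a ha := by
    change (f _ : B) ∈ I
    rw [coe_subst]
    exact hI.subst_mem _ _ ha

variable [Infinite ι]

theorem exists_cyl_pull (ρ : ι ↪ κ) (Γ : Set κ) (a : A) :
    ∃ b, cyl Γ (f.pull ρ a) = f.pull ρ b := by
  by_cases h : ∃ k, k ∉ Γ
  · obtain ⟨k, hk⟩ := h
    exact ⟨_, f.cyl_pull_of_notMem ρ hk a⟩
  -- Here `Γ` is all of `κ`; it is split into two proper subsets, each handled by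
  -- `cyl_pull_of_notMem`.
  · obtain ⟨i, j, hij⟩ := exists_pair_ne ι
    have hΓ : Γ = {e i}ᶜ ∪ {e i} := by
      rw [compl_union_self]
      exact eq_univ_of_forall fun k => not_not.1 fun hk => h ⟨k, hk⟩
    have hj : e j ∉ ({e i} : Set κ) := fun h => hij (e.injective h).symm
    have hi : e i ∉ ({e i}ᶜ : Set κ) := fun h => h rfl
    exact ⟨_, by rw [hΓ, ← cyl_cyl, f.cyl_pull_of_notMem ρ hj, f.cyl_pull_of_notMem ρ hi]⟩

/-- The elements `s_ρ a` form a Boolean subalgebra. -/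
noncomputable def pullSubalgebra : BooleanSubalgebra B where
  carrier := {b | ∃ (ρ : ι → κ) (a : A), b = f.pull ρ a}
  supClosed' := by
    rintro _ ⟨σ, a, rfl⟩ _ ⟨τ, b, rfl⟩
    obtain ⟨ρ, σ', τ', rfl, rfl⟩ := exists_embedding_factor e σ τ
    refine ⟨ρ, subst σ' a ⊔ subst τ' b, ?_⟩
    rw [pull_comp, pull_comp, pull, pull, pull, coe_sup, subst_sup]
  infClosed' := by
    rintro _ ⟨σ, a, rfl⟩ _ ⟨τ, b, rfl⟩
    obtain ⟨ρ, σ', τ', rfl, rfl⟩ := exists_embedding_factor e σ τ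
    refine ⟨ρ, subst σ' a ⊓ subst τ' b, ?_⟩
    rw [pull_comp, pull_comp, pull, pull, pull, coe_inf, polyadic_subst_inf]
  compl_mem' := by
    rintro _ ⟨σ, a, rfl⟩
    exact ⟨σ, aᶜ, by rw [pull, pull, coe_compl, subst_compl]⟩
  bot_mem' := ⟨e, ⊥, by rw [pull_self, coe_bot]⟩

theorem exists_embedding_pull {b : B} (hb : b ∈ f.pullSubalgebra) :
    ∃ (ρ : ι ↪ κ) (a : A), b = f.pull ρ a := by
  obtain ⟨σ, a, rfl⟩ := hb
  obtain ⟨ρ, σ', -, rfl, -⟩ := exists_embedding_factor e σ e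
  exact ⟨ρ, subst σ' a, f.pull_comp ρ σ' a⟩

theorem isPolyadicEqualitySubalgebra_pullSubalgebra :
    IsPolyadicEqualitySubalgebra κ f.pullSubalgebra where
  cyl_mem Γ x hx := by
    obtain ⟨ρ, a, rfl⟩ := f.exists_embedding_pull hx
    obtain ⟨b, hb⟩ := f.exists_cyl_pull ρ Γ a
    exact ⟨ρ, b, hb⟩
  subst_mem τ x := by
    rintro ⟨σ, a, rfl⟩
    exact ⟨τ ∘ σ, a, f.subst_pull τ σ a⟩
  diag_mem p q := by
    obtain ⟨ρ, -, k, l, -, rfl, rfl⟩ := exists_embedding_factor_pair e e p q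
    refine ⟨ρ, diag k l, ?_⟩
    rw [pull, coe_diag, subst_diag, e.injective.extend_apply, e.injective.extend_apply]

variable {f}

theorem exists_eq_pull (hf : PolyadicGenerates κ (range fun a : A => (f a : B))) (b : B) :
    ∃ (ρ : ι ↪ κ) (a : A), b = f.pull ρ a := by
  refine f.exists_embedding_pull
    (hf _ f.isPolyadicEqualitySubalgebra_pullSubalgebra ?_ b)
  rintro _ ⟨a, rfl⟩
  exact ⟨e, a, (f.pull_self a).symm⟩

/-- Substituting along `e ∘ θ`, with `θ` a left inverse of `ρ`, undoes `ρ`. -/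
theorem coe_mem_of_pull_mem {I : Order.Ideal B} (hI : IsPolyadicIdeal κ I) {ρ : ι ↪ κ} {a : A}
    (h : f.pull ρ a ∈ I) : (f a : B) ∈ I := by
  obtain ⟨θ, hθ⟩ := ρ.exists_leftInverse_comp
  have h' := hI.subst_mem (e ∘ θ) _ h
  rwa [subst_pull, comp_assoc, hθ, comp_id, pull_self] at h'

/-- Every ideal of `B` is generated by its trace on a generating subalgebra of a compression. -/
theorem eq_polyadicIdealGenerated
    (hf : PolyadicGenerates κ (range fun a : A => (f a : B)))
    {I : Order.Ideal B} (hI : IsPolyadicIdeal κ I) :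
    I = polyadicIdealGenerated κ ((I : Set B) ∩ range fun a : A => (f a : B)) := by
  refine le_antisymm (fun b hb => ?_) (sInf_le ⟨hI, inter_subset_left⟩)
  refine Order.Ideal.mem_sInf.2 fun L hL => ?_
  obtain ⟨ρ, a, rfl⟩ := exists_eq_pull hf b
  exact hL.1.subst_mem _ _ (hL.2 ⟨coe_mem_of_pull_mem hI hb, a, rfl⟩)

theorem isPolyadicSimple_of_generates (hinj : Injective f)
    (hf : PolyadicGenerates κ (range fun a : A => (f a : B)))
    (hA : IsPolyadicSimple ι A) : IsPolyadicSimple κ B := by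
  obtain ⟨hnt, hsimple⟩ := hA
  refine ⟨(Subtype.val_injective.comp hinj).nontrivial, fun I hI => ?_⟩
  rcases hsimple _ (f.isPolyadicIdeal_idealComap hI) with h | h
  · refine Or.inl (eq_bot_iff.2 fun b hb => ?_)
    obtain ⟨ρ, a, rfl⟩ := exists_eq_pull hf b
    have ha : a ∈ idealComap f I := coe_mem_of_pull_mem hI hb
    rw [h] at ha
    replace ha : a = ⊥ := le_bot_iff.1 ha
    rw [ha, pull, coe_bot, polyadic_subst_bot]
    exact Order.Ideal.bot_mem _
  · have ha : (⊤ : A) ∈ idealComap f I := h ▸ mem_univ _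
    refine Or.inr (Order.Ideal.top_of_top_mem ?_)
    rw [← f.coe_top]
    exact ha

end PolyadicEqualityHom

theorem mainTheorem3 (α β : Ordinal.{u}) (hα : ω ≤ α) (hαβ : α < β)
    (A : Type v) [BooleanAlgebra A] [PEA α A] :
    (∃ (B : Type (max (u + 1) v)) (_ : BooleanAlgebra B) (_ : PEA β B)
        (f : PolyadicEqualityHom (Iio α) A (Nr hαβ.le B)),
        Injective f ∧
        ∀ b : B, ∃ (a : A) (σ : Iio β → Iio β),
          InjOn σ {i : Iio β | (i : Ordinal.{u}) < α} ∧
          b = PolyadicAlgebra.subst σ (f a : B)) ∧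
    (∀ (B : Type w) [BooleanAlgebra B] [PEA β B]
        (f : PolyadicEqualityHom (Iio α) A (Nr hαβ.le B)),
        Injective f →
        PolyadicGenerates (Iio β) (range fun a : A => (f a : B)) →
        (IsPolyadicSimple (Iio α) A → IsPolyadicSimple (Iio β) B) ∧
        ∀ I : Order.Ideal B, IsPolyadicIdeal (Iio β) I →
          I = polyadicIdealGenerated (Iio β) ((I : Set B) ∩ range fun a : A => (f a : B))) := by
  have : Infinite (Iio α) :=
    Infinite.of_injective
      (fun n : ℕ => (⟨n, (Ordinal.natCast_lt_omega0 n).trans_le hα⟩ : Iio α))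
      fun m n h => Nat.cast_injective (R := Ordinal.{u}) (congrArg Subtype.val h)
  refine ⟨⟨dilation A (ordinalInclusion hαβ.le), inferInstance,
    dilation.instPolyadicEqualityAlgebra _, dilation.embed _, dilation.embed_injective _,
    fun b => ?_⟩, ?_⟩
  · obtain ⟨a, σ, hσ, h⟩ := dilation.exists_subst_embed _ b
    exact ⟨a, σ, hσ.mono fun i hi => mem_range.2 ⟨⟨i.1, hi⟩, rfl⟩, h⟩
  · intro B _ _ f hinj hf
    exact ⟨PolyadicEqualityHom.isPolyadicSimple_of_generates hinj hf,
      fun I hI => PolyadicEqualityHom.eq_polyadicIdealGenerated hf hI⟩
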